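/- Write points of $\mathbb R^6$ as $\xi=(\xi_{11},\xi_{12},\xi_{21},\xi_{22},\xi_{31},\xi_{32})$ and let $|\cdot|$ be the Euclidean norm. For a convex body (compact convex set) $K\subset\mathbb R^6$ with the origin in its interior let $\|x\|_K=\min\{a\ge 0 : x\in aK\}$ be its Minkowski functional. Call $K$ $R_\theta$-invariant if for every $\theta\in[0,2\pi]$ and every $\xi\in\mathbb R^6$ one has $\|\xi\|_K=\|(R_\theta(\xi_{11},\xi_{12}),R_\theta(\xi_{21},\xi_{22}),R_\theta(\xi_{31},\xi_{32}))\|_K$, where $R_\theta$ is the counterclockwise rotation of $\mathbb R^2$ by the angle $\theta$; call $K$ infinitely smooth if the restriction of $\|\cdot\|_K$ to the unit sphere $S^5$ is $C^\infty$. A tempered distribution $f$ on $\mathbb R^6$ is positive definite if $\langle f,\varphi*\widetilde\varphi\rangle\ge 0$ for every complex-valued Schwartz function $\varphi$, where $\widetilde\varphi(x)=\overline{\varphi(-x)}$. Lemma. There is an infinitely smooth $R_\theta$-invariant convex body $K$ in $\mathbb R^6$, with the origin in its interior and contained in the open unit ball, such that the function $$x\longmapsto \frac{\|x\|_K^{-2}}{1-\left(\frac{|x|}{\|x\|_K}\right)^2}$$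 defines, by integration, a tempered distribution on $\mathbb R^6$ that is not positive definite. -/

import Mathlib

open MeasureTheory Metric
open scoped SchwartzMap Manifold ContDiff ComplexOrder ComplexConjugate

noncomputable section

/-- Euclidean six-space `ℝ⁶`, with coordinates `(ξ₁₁, ξ₁₂, ξ₂₁, ξ₂₂, ξ₃₁, ξ₃₂)`. -/
abbrev R6 : Type := EuclideanSpace ℝ (Fin 6)

/-- The counterclockwise rotation by the angle `θ` applied to each of the three coordinate pairs
`(ξ₁₁, ξ₁₂)`, `(ξ₂₁, ξ₂₂)`, `(ξ₃₁, ξ₃₂)`. -/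
def rot6 (θ : ℝ) (ξ : R6) : R6 :=
  !₂[Real.cos θ * ξ 0 - Real.sin θ * ξ 1, Real.sin θ * ξ 0 + Real.cos θ * ξ 1,
     Real.cos θ * ξ 2 - Real.sin θ * ξ 3, Real.sin θ * ξ 2 + Real.cos θ * ξ 3,
     Real.cos θ * ξ 4 - Real.sin θ * ξ 5, Real.sin θ * ξ 4 + Real.cos θ * ξ 5]

/-- `K` is `R_θ`-invariant: its Minkowski functional is unchanged under all the coordinate-wise
rotations. -/
def IsRotationInvariant (K : Set R6) : Prop :=
  ∀ θ ∈ Set.Icc 0 (2 * Real.pi), ∀ ξ : R6, gauge K ξ = gauge K (rot6 θ ξ)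

/-- `K` is infinitely smooth: the restriction of its Minkowski functional to the unit sphere is
a `C^∞` function on the sphere. -/
def IsInfinitelySmooth (K : Set R6) : Prop :=
  ContMDiff (𝓡 5) 𝓘(ℝ, ℝ) ∞ (fun x : sphere (0 : R6) 1 => gauge K (x : R6))

/-- The function `‖x‖_K⁻² / (1 - (|x| / ‖x‖_K)²)`. -/
def density (K : Set R6) (x : R6) : ℝ :=
  (gauge K x ^ 2)⁻¹ / (1 - (‖x‖ / gauge K x) ^ 2)

/-- The tempered distribution `T` is the one given by integration against the function `f`. -/
def IsGivenBy (T : 𝓢'(R6, ℂ)) (f : R6 → ℝ) : Prop :=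
  ∀ φ : 𝓢(R6, ℂ), Integrable (fun x => (f x : ℂ) * φ x) ∧ T φ = ∫ x, (f x : ℂ) * φ x

/-- The test function `x ↦ conj (φ (-x))`. -/
def conjReflect (φ : 𝓢(R6, ℂ)) : 𝓢(R6, ℂ) :=
  SchwartzMap.postcompCLM (Complex.conjCLE : ℂ →L[ℝ] ℂ)
    (SchwartzMap.compCLMOfContinuousLinearEquiv ℂ (ContinuousLinearEquiv.neg ℝ) φ)

theorem conjReflect_apply (φ : 𝓢(R6, ℂ)) (x : R6) : conjReflect φ x = conj (φ (-x)) := rfl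

/-- A tempered distribution `T` is positive definite if `⟨T, φ ∗ conj (φ (-·))⟩ ≥ 0` for every
test function `φ` (in particular, this number is real). -/
def IsPositiveDefinite (T : 𝓢'(R6, ℂ)) : Prop :=
  ∀ φ : 𝓢(R6, ℂ),
    0 ≤ T (SchwartzMap.convolution (ContinuousLinearMap.mul ℂ ℂ) φ (conjReflect φ))

end

noncomputable section

/-! ### The convex body -/

/-! Write A = `headSq`, B = `tailSq`, so |x|² = A + B, and let N be the squared Minkowski
functional. The density is then 1/(N - |x|²). The body is designed backwards from the density 3/(A +
B) - 1/(A + B/2): solving for N gives `bodyNormSq`.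

Why this density: on ℝ⁶ the Fourier transform of 1/(A + mB), evaluated at a nonzero frequency along
the first axis, is proportional to m⁻², since the tail has four coordinates. The combination is
therefore proportional to 3 - 4 < 0 there, although the density itself is positive off the origin.
To detect this, the test function is a Gaussian modulated along the first axis. Its autocorrelation
is again a modulated Gaussian, and writing 1/q = ∫ exp(-qs) ds reduces the pairing to a one-variable
integral, which is bounded by that of an explicit negative total derivative
(`gaussianTransform_combination_le`, `hasDerivAt_exp_div_sq`).

Convexity holds because N is a maximum of nonnegative quadratic forms (`bodyNormSq_le_one_iff`). -/

/-- The squared norm of the first coordinate pair. -/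
def headSq (x : R6) : ℝ := x 0 ^ 2 + x 1 ^ 2

/-- The squared norm of the last two coordinate pairs. -/
def tailSq (x : R6) : ℝ := x 2 ^ 2 + x 3 ^ 2 + x 4 ^ 2 + x 5 ^ 2

theorem headSq_nonneg (x : R6) : 0 ≤ headSq x := by unfold headSq; positivity

theorem tailSq_nonneg (x : R6) : 0 ≤ tailSq x := by unfold tailSq; positivity

theorem norm_sq_eq (x : R6) : ‖x‖ ^ 2 = headSq x + tailSq x := by
  rw [EuclideanSpace.real_norm_sq_eq, headSq, tailSq]
  simp [Fin.sum_univ_six]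
  ring

theorem headSq_smul (r : ℝ) (x : R6) : headSq (r • x) = r ^ 2 * headSq x := by
  simp [headSq]; ring

theorem tailSq_smul (r : ℝ) (x : R6) : tailSq (r • x) = r ^ 2 * tailSq x := by
  simp [tailSq]; ring

theorem headSq_rot6 (θ : ℝ) (x : R6) : headSq (rot6 θ x) = headSq x := by
  simp [headSq, rot6]
  linear_combination (x 0 ^ 2 + x 1 ^ 2) * Real.sin_sq_add_cos_sq θ

theorem tailSq_rot6 (θ : ℝ) (x : R6) : tailSq (rot6 θ x) = tailSq x := by
  simp [tailSq, rot6]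
  linear_combination (x 2 ^ 2 + x 3 ^ 2 + x 4 ^ 2 + x 5 ^ 2) * Real.sin_sq_add_cos_sq θ

theorem headSq_add_mul_tailSq_pos {m : ℝ} (hm : 0 < m) {x : R6} (hx : x ≠ 0) :
    0 < headSq x + m * tailSq x := by
  have h : 0 < headSq x + tailSq x := by rw [← norm_sq_eq]; positivity
  have hA := headSq_nonneg x
  have hB := tailSq_nonneg x
  rcases hA.eq_or_lt with h0 | h0
  · have : 0 < tailSq x := by linarith
    positivity
  · positivity

theorem contDiff_headSq : ContDiff ℝ ∞ headSq := by unfold headSq; fun_prop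

theorem contDiff_tailSq : ContDiff ℝ ∞ tailSq := by unfold tailSq; fun_prop

theorem convexOn_coord_sq (i : Fin 6) : ConvexOn ℝ Set.univ (fun x : R6 => x i ^ 2) :=
  (even_two.convexOn_pow (𝕜 := ℝ)).comp_linearMap
    (EuclideanSpace.proj (𝕜 := ℝ) i : R6 →L[ℝ] ℝ).toLinearMap

theorem convexOn_headSq : ConvexOn ℝ Set.univ headSq :=
  (convexOn_coord_sq 0).add (convexOn_coord_sq 1)

theorem convexOn_tailSq : ConvexOn ℝ Set.univ tailSq :=
  (((convexOn_coord_sq 2).add (convexOn_coord_sq 3)).add (convexOn_coord_sq 4)).add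
    (convexOn_coord_sq 5)

/-- The square of the Minkowski functional of the body. -/
def bodyNormSq (x : R6) : ℝ :=
  2 * (headSq x + tailSq x) * (3 * headSq x + tailSq x) / (4 * headSq x + tailSq x)

theorem bodyNormSq_smul (r : ℝ) (x : R6) : bodyNormSq (r • x) = r ^ 2 * bodyNormSq x := by
  rcases eq_or_ne r 0 with rfl | hr
  · simp [bodyNormSq, headSq, tailSq]
  · rw [bodyNormSq, bodyNormSq, headSq_smul, tailSq_smul, ← mul_div_assoc,
      show 2 * (r ^ 2 * headSq x + r ^ 2 * tailSq x) * (3 * (r ^ 2 * headSq x) + r ^ 2 * tailSq x)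
        = r ^ 2 * (r ^ 2 * (2 * (headSq x + tailSq x) * (3 * headSq x + tailSq x))) by ring,
      show 4 * (r ^ 2 * headSq x) + r ^ 2 * tailSq x
        = r ^ 2 * (4 * headSq x + tailSq x) by ring,
      mul_div_mul_left _ _ (by positivity)]

theorem four_mul_headSq_add_tailSq_pos {x : R6} (hx : x ≠ 0) : 0 < 4 * headSq x + tailSq x := by
  have := headSq_add_mul_tailSq_pos (m := 1 / 4) (by norm_num) hx
  linarith

theorem norm_sq_lt_bodyNormSq {x : R6} (hx : x ≠ 0) : ‖x‖ ^ 2 < bodyNormSq x := by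
  have h1 := four_mul_headSq_add_tailSq_pos hx
  have h2 := headSq_add_mul_tailSq_pos one_pos hx
  have h3 := headSq_add_mul_tailSq_pos (m := 1 / 2) (by norm_num) hx
  rw [norm_sq_eq, bodyNormSq, lt_div_iff₀ h1]
  nlinarith [mul_pos h2 h3]

theorem bodyNormSq_le (x : R6) : bodyNormSq x ≤ 2 * ‖x‖ ^ 2 := by
  have hA := headSq_nonneg x
  have hB := tailSq_nonneg x
  rw [norm_sq_eq, bodyNormSq]
  refine div_le_of_le_mul₀ (by positivity) (by positivity) ?_
  nlinarith [mul_nonneg hA hA, mul_nonneg hA hB]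

/-- The squared Minkowski functional is a maximum of nonnegative quadratic forms. -/
theorem bodyNormSq_le_one_iff (x : R6) :
    bodyNormSq x ≤ 1 ↔ ∀ l ∈ Set.Icc (0 : ℝ) (1 / 4),
      12 * l * (1 - 2 * l) * headSq x + (2 - 6 * l ^ 2) * tailSq x ≤ 1 := by
  rcases eq_or_ne x 0 with rfl | hx
  · simp [bodyNormSq, headSq, tailSq]
  have hD := four_mul_headSq_add_tailSq_pos hx
  -- With D = 4A + B one has N = 2B + 6A²/D. Expanding the square (A - lD)² bounds A²/D below by a
  -- form linear in A and B.
  have key : ∀ l : ℝ, bodyNormSq x =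
      12 * l * (1 - 2 * l) * headSq x + (2 - 6 * l ^ 2) * tailSq x
        + 6 * (headSq x - l * (4 * headSq x + tailSq x)) ^ 2 / (4 * headSq x + tailSq x) := by
    intro l
    rw [bodyNormSq, div_eq_iff hD.ne', add_mul, div_mul_cancel₀ _ hD.ne']
    ring
  constructor
  · intro h l _
    have : 0 ≤ 6 * (headSq x - l * (4 * headSq x + tailSq x)) ^ 2 / (4 * headSq x + tailSq x) := by
      positivity
    linarith [key l]
  · intro h
    -- This value of l makes the square vanish, so the maximum is attained.
    have hl : headSq x / (4 * headSq x + tailSq x) ∈ Set.Icc (0 : ℝ) (1 / 4) := by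
      refine ⟨div_nonneg (headSq_nonneg x) hD.le, ?_⟩
      rw [div_le_iff₀ hD]
      linarith [tailSq_nonneg x]
    rw [key (headSq x / (4 * headSq x + tailSq x)), div_mul_cancel₀ _ hD.ne']
    simpa using h _ hl

/-- The carrier of the body. -/
def bodySet : Set R6 := {x | bodyNormSq x ≤ 1}

theorem bodySet_eq_iInter : bodySet = ⋂ l ∈ Set.Icc (0 : ℝ) (1 / 4),
    {x | 12 * l * (1 - 2 * l) * headSq x + (2 - 6 * l ^ 2) * tailSq x ≤ 1} := by
  ext x
  simp only [bodySet, Set.mem_ofPred_eq, bodyNormSq_le_one_iff, Set.mem_iInter]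

/-- For l in [0, 1/4] both coefficients are nonnegative, so each set in the intersection is a
sublevel set of a convex function. -/
theorem convex_bodySet : Convex ℝ bodySet := by
  rw [bodySet_eq_iInter]
  refine convex_iInter₂ fun l hl => ?_
  have h1 : 0 ≤ 12 * l * (1 - 2 * l) :=
    mul_nonneg (by linarith [hl.1]) (by linarith [hl.2])
  have h2 : 0 ≤ 2 - 6 * l ^ 2 := by nlinarith [hl.1, hl.2]
  simpa using ((convexOn_headSq.smul h1).add (convexOn_tailSq.smul h2)).convex_le 1

theorem isClosed_bodySet : IsClosed bodySet := by
  rw [bodySet_eq_iInter]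
  refine isClosed_biInter fun l _ => ?_
  have := contDiff_headSq.continuous
  have := contDiff_tailSq.continuous
  exact isClosed_le (by fun_prop) continuous_const

theorem bodySet_subset_ball : bodySet ⊆ ball 0 1 := by
  intro x hx
  rcases eq_or_ne x 0 with rfl | h0
  · simp
  have := (norm_sq_lt_bodyNormSq h0).trans_le hx
  rw [mem_ball_zero_iff]
  nlinarith [norm_nonneg x]

theorem zero_mem_interior_bodySet : (0 : R6) ∈ interior bodySet := by
  refine mem_interior.2 ⟨ball 0 (1 / 2), fun x hx => ?_, isOpen_ball, by simp⟩
  rw [mem_ball_zero_iff] at hx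
  refine (bodyNormSq_le x).trans ?_
  nlinarith [norm_nonneg x]

/-- The convex body. -/
def body : ConvexBody R6 where
  carrier := bodySet
  convex' := convex_bodySet
  isCompact' := (isCompact_closedBall (0 : R6) 1).of_isClosed_subset isClosed_bodySet
    (bodySet_subset_ball.trans ball_subset_closedBall)
  nonempty' := ⟨0, interior_subset zero_mem_interior_bodySet⟩

open scoped Pointwise in
theorem gauge_bodySet (x : R6) : gauge bodySet x = √(bodyNormSq x) := by
  have h : {r : ℝ | 0 < r ∧ x ∈ r • bodySet} = {r : ℝ | 0 < r ∧ √(bodyNormSq x) ≤ r} := by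
    ext r
    simp only [Set.mem_ofPred_eq]
    refine and_congr_right fun hr => ?_
    rw [Set.mem_smul_set_iff_inv_smul_mem₀ hr.ne', bodySet, Set.mem_ofPred_eq, bodyNormSq_smul,
      Real.sqrt_le_left hr.le, inv_pow, inv_mul_le_iff₀ (by positivity), mul_one]
  rw [gauge, h]
  apply le_antisymm
  · refine le_of_forall_pos_le_add fun ε hε => csInf_le ⟨0, fun r hr => hr.1.le⟩ ⟨?_, ?_⟩
    · positivity
    · linarith
  · refine le_csInf ⟨√(bodyNormSq x) + 1, by positivity, by linarith⟩ fun r hr => hr.2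

theorem isRotationInvariant_bodySet : IsRotationInvariant bodySet := by
  intro θ _ ξ
  rw [gauge_bodySet, gauge_bodySet, bodyNormSq, bodyNormSq, headSq_rot6, tailSq_rot6]

theorem isInfinitelySmooth_bodySet : IsInfinitelySmooth bodySet := by
  have : Fact (Module.finrank ℝ R6 = 5 + 1) := ⟨by simp⟩
  intro x
  have hx : (x : R6) ≠ 0 := ne_zero_of_mem_unit_sphere x
  have hD := four_mul_headSq_add_tailSq_pos hx
  have hN : bodyNormSq (x : R6) ≠ 0 :=
    ((sq_nonneg _).trans_lt (norm_sq_lt_bodyNormSq hx)).ne'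
  have hA := contDiff_headSq.contDiffAt (x := (x : R6))
  have hB := contDiff_tailSq.contDiffAt (x := (x : R6))
  have h1 : ContDiffAt ℝ ∞ bodyNormSq (x : R6) :=
    ((contDiffAt_const.mul (hA.add hB)).mul ((contDiffAt_const.mul hA).add hB)).div
      ((contDiffAt_const.mul hA).add hB) hD.ne'
  have h2 : ContDiffAt ℝ ∞ (gauge bodySet) (x : R6) := by
    rw [funext gauge_bodySet]
    exact h1.sqrt hN
  exact ContMDiffAt.comp (g := gauge bodySet) (I' := 𝓘(ℝ, R6)) x h2.contMDiffAt
    (contMDiff_coe_sphere (E := R6) (n := 5) x)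

/-- N - |x|² = (A + B)(2A + B)/(4A + B); inverting and splitting into partial fractions gives the
difference. At the origin both sides are 0 because 0⁻¹ = 0. -/
theorem density_bodySet (x : R6) :
    density bodySet x =
      3 * (headSq x + 1 * tailSq x)⁻¹ - (headSq x + 1 / 2 * tailSq x)⁻¹ := by
  rcases eq_or_ne x 0 with rfl | hx
  · simp [density, headSq, tailSq]
  have h1 := four_mul_headSq_add_tailSq_pos hx
  have h2 := headSq_add_mul_tailSq_pos one_pos hx
  have h3 := headSq_add_mul_tailSq_pos (m := 1 / 2) (by norm_num) hx
  have hN := norm_sq_lt_bodyNormSq hx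
  have hN0 : 0 < bodyNormSq x := (sq_nonneg _).trans_lt hN
  have hsub : bodyNormSq x - ‖x‖ ^ 2
      = 2 * (headSq x + 1 * tailSq x) * (headSq x + 1 / 2 * tailSq x)
        / (4 * headSq x + tailSq x) := by
    rw [norm_sq_eq, bodyNormSq, eq_div_iff h1.ne', sub_mul, div_mul_cancel₀ _ h1.ne']
    ring
  have : density bodySet x = (bodyNormSq x - ‖x‖ ^ 2)⁻¹ := by
    rw [density, gauge_bodySet, div_pow, Real.sq_sqrt hN0.le]
    have : bodyNormSq x - ‖x‖ ^ 2 ≠ 0 := (sub_pos.2 hN).ne'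
    field_simp
  rw [this, hsub, inv_div, ← div_eq_mul_inv, inv_eq_one_div, div_sub_div _ _ h2.ne' h3.ne',
    div_eq_div_iff (by positivity) (by positivity)]
  ring

/-! ### Modulated Gaussians as Schwartz functions -/

theorem iteratedDeriv_cexp_const_mul_ofReal (n : ℕ) (c : ℂ) :
    iteratedDeriv n (fun t : ℝ => Complex.exp (c * t)) =
      fun t : ℝ => c ^ n * Complex.exp (c * t) := by
  induction n with
  | zero => simp
  | succ n ih =>
    rw [iteratedDeriv_succ, ih]
    ext t
    have h : HasDerivAt (fun t : ℝ => c ^ n * Complex.exp (c * t))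
        (c ^ n * (Complex.exp (c * t) * (c * 1))) t :=
      ((((Complex.ofRealCLM.hasDerivAt (x := t)).const_mul c).cexp).const_mul (c ^ n))
    rw [h.deriv]
    ring

theorem contDiff_cexp_const_mul_ofReal (c : ℂ) :
    ContDiff ℝ ∞ (fun t : ℝ => Complex.exp (c * t)) :=
  (contDiff_const.mul Complex.ofRealCLM.contDiff).cexp

theorem hasTemperateGrowth_cexp_mul_I (a : ℝ) :
    (fun t : ℝ => Complex.exp (a * Complex.I * t)).HasTemperateGrowth := by
  refine ⟨contDiff_cexp_const_mul_ofReal _, fun n => ⟨0, |a| ^ n, fun t => ?_⟩⟩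
  rw [norm_iteratedFDeriv_eq_norm_iteratedDeriv, iteratedDeriv_cexp_const_mul_ofReal]
  simp [Complex.norm_exp]

theorem pow_mul_exp_neg_sq_bounded (k : ℕ) :
    ∃ C : ℝ, ∀ r : ℝ, 0 ≤ r → (1 + r) ^ k * Real.exp (-r ^ 2) ≤ C := by
  -- The exponential series gives (1 + r)^k ≤ k! exp(1 + r), and 1 + r - r² ≤ 2.
  refine ⟨k.factorial * Real.exp 2, fun r hr => ?_⟩
  have h := Real.pow_div_factorial_le_exp (1 + r) (by positivity) k
  rw [div_le_iff₀ (by positivity)] at h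
  calc (1 + r) ^ k * Real.exp (-r ^ 2)
      ≤ (Real.exp (1 + r) * k.factorial) * Real.exp (-r ^ 2) := by gcongr
    _ = k.factorial * Real.exp (1 + r - r ^ 2) := by
        rw [sub_eq_add_neg, Real.exp_add (1 + r)]; ring
    _ ≤ k.factorial * Real.exp 2 := by
        gcongr
        nlinarith [sq_nonneg (r - 1 / 2)]

section Gaussian

variable {E : Type*} [NormedAddCommGroup E] [InnerProductSpace ℝ E]

/-- The Gaussian `exp (-‖x‖²)` as a Schwartz function. -/
def schwartzGaussian : 𝓢(E, ℂ) where
  toFun x := Complex.exp (-1 * (‖x‖ ^ 2 : ℝ))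
  smooth' := (contDiff_cexp_const_mul_ofReal (-1)).comp (contDiff_norm_sq ℝ)
  decay' := by
    intro k n
    obtain ⟨l, C, hC, hf⟩ :=
      (Function.hasTemperateGrowth_norm_sq (H := E)).norm_iteratedFDeriv_le_uniform n
    obtain ⟨M, hM⟩ := pow_mul_exp_neg_sq_bounded (k + l * n)
    refine ⟨n.factorial * (1 + C) ^ n * M, fun x => ?_⟩
    have hx := norm_nonneg x
    -- The chain-rule estimate wants the i-th derivative bounded by an i-th power. Using 1 + C makes
    -- the base at least 1, so one bound serves every i ≥ 1.
    have hD1 : 1 ≤ (1 + C) * (1 + ‖x‖) ^ l :=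
      one_le_mul_of_one_le_of_one_le (by linarith) (one_le_pow₀ (by linarith))
    have key : ‖iteratedFDeriv ℝ n
        ((fun t : ℝ => Complex.exp (-1 * t)) ∘ fun x : E => ‖x‖ ^ 2) x‖
          ≤ n.factorial * Real.exp (-‖x‖ ^ 2) * ((1 + C) * (1 + ‖x‖) ^ l) ^ n := by
      refine norm_iteratedFDeriv_comp_le (contDiff_cexp_const_mul_ofReal (-1))
        (contDiff_norm_sq ℝ) (by exact_mod_cast le_top) x (fun i _ => ?_) (fun i h1 hi => ?_)
      · rw [norm_iteratedFDeriv_eq_norm_iteratedDeriv, iteratedDeriv_cexp_const_mul_ofReal]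
        simp [Complex.norm_exp, -Complex.ofReal_pow]
      · calc _ ≤ C * (1 + ‖x‖) ^ l := hf i hi x
          _ ≤ (1 + C) * (1 + ‖x‖) ^ l := by gcongr; linarith
          _ ≤ _ := le_self_pow₀ hD1 (by omega)
    calc ‖x‖ ^ k * ‖iteratedFDeriv ℝ n
          ((fun t : ℝ => Complex.exp (-1 * t)) ∘ fun x : E => ‖x‖ ^ 2) x‖
        ≤ (1 + ‖x‖) ^ k *
          (n.factorial * Real.exp (-‖x‖ ^ 2) * ((1 + C) * (1 + ‖x‖) ^ l) ^ n) := by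
          gcongr
          linarith
      _ = n.factorial * (1 + C) ^ n * ((1 + ‖x‖) ^ (k + l * n) * Real.exp (-‖x‖ ^ 2)) := by
          rw [mul_pow, pow_add, pow_mul]; ring
      _ ≤ n.factorial * (1 + C) ^ n * M := by
          gcongr
          exact hM _ hx

end Gaussian

/-- The modulated Gaussian `exp (i a x₀ - ‖x‖²)`. -/
def modulatedGaussian (a : ℝ) : 𝓢(R6, ℂ) :=
  SchwartzMap.smulLeftCLM ℂ (fun x : R6 => Complex.exp (a * Complex.I * (x 0 : ℝ)))
    schwartzGaussian

theorem modulatedGaussian_apply (a : ℝ) (x : R6) :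
    modulatedGaussian a x = Complex.exp (a * Complex.I * x 0 - ‖x‖ ^ 2) := by
  have h : (fun x : R6 => Complex.exp (a * Complex.I * (x 0 : ℝ))).HasTemperateGrowth :=
    (hasTemperateGrowth_cexp_mul_I a).comp
      (EuclideanSpace.proj (𝕜 := ℝ) (0 : Fin 6) : R6 →L[ℝ] ℝ).hasTemperateGrowth
  rw [modulatedGaussian, SchwartzMap.smulLeftCLM_apply_apply h, smul_eq_mul]
  change _ * Complex.exp (-1 * (‖x‖ ^ 2 : ℝ)) = _
  rw [← Complex.exp_add]
  push_cast
  ring_nf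

/-- The autocorrelation of the modulated Gaussian. -/
theorem convolution_modulatedGaussian (a : ℝ) (x : R6) :
    SchwartzMap.convolution (ContinuousLinearMap.mul ℂ ℂ) (modulatedGaussian a)
        (conjReflect (modulatedGaussian a)) x =
      ((Real.pi / 2) ^ 3 : ℝ) * Complex.exp (a * Complex.I * x 0 - ‖x‖ ^ 2 / 2) := by
  have hpt : ∀ y : R6, modulatedGaussian a y * conj (modulatedGaussian a (-(x - y))) =
      (Real.exp (-2 * ‖y - (1 / 2 : ℝ) • x‖ ^ 2) : ℝ) *
        Complex.exp (a * Complex.I * x 0 - ‖x‖ ^ 2 / 2) := by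
    intro y
    have h1 : ‖x - y‖ ^ 2 = ‖x‖ ^ 2 - 2 * inner ℝ x y + ‖y‖ ^ 2 := norm_sub_sq_real x y
    have h2 : ‖y - (1 / 2 : ℝ) • x‖ ^ 2 = ‖y‖ ^ 2 - inner ℝ x y + ‖x‖ ^ 2 / 4 := by
      rw [norm_sub_sq_real, inner_smul_right, norm_smul, real_inner_comm]
      norm_num
      ring
    have h1' : (‖x - y‖ : ℂ) ^ 2 = ‖x‖ ^ 2 - 2 * (inner ℝ x y : ℝ) + ‖y‖ ^ 2 := by
      exact_mod_cast congrArg Complex.ofReal h1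
    rw [h2, modulatedGaussian_apply, modulatedGaussian_apply, ← Complex.exp_conj,
      Complex.ofReal_exp, ← Complex.exp_add, ← Complex.exp_add]
    congr 1
    simp only [map_sub, map_mul, map_pow, Complex.conj_ofReal, Complex.conj_I, norm_neg,
      PiLp.neg_apply, PiLp.sub_apply]
    rw [h1']
    push_cast
    ring
  rw [SchwartzMap.convolution_apply, convolution_def]
  simp only [ContinuousLinearMap.mul_apply', conjReflect_apply, hpt]
  rw [integral_mul_const, integral_complex_ofReal,
    integral_sub_right_eq_self (fun y : R6 => Real.exp (-2 * ‖y‖ ^ 2)),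
    GaussianFourier.integral_rexp_neg_mul_sq_norm two_pos]
  norm_num

/-! ### The tempered distribution -/

/-- In polar coordinates the radial weight r⁵ absorbs the singularity r⁻², and the remaining r³(1 +
r)⁻⁸ is at most (1 + r)⁻⁵. -/
theorem integrable_inv_norm_sq_mul_one_add_norm_rpow :
    Integrable (fun x : R6 => (‖x‖ ^ 2)⁻¹ * (1 + ‖x‖) ^ (-(8 : ℝ))) := by
  rw [integrable_fun_norm_addHaar (E := R6) volume
    (f := fun y : ℝ => (y ^ 2)⁻¹ * (1 + y) ^ (-(8 : ℝ)))]
  refine (integrableOn_add_rpow_Ioi_of_lt (a := -5) (c := 0) (m := 1) (by norm_num)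
    (by norm_num)).mono' ?_ ?_
  · exact (by fun_prop : Measurable _).aestronglyMeasurable
  · filter_upwards [ae_restrict_mem measurableSet_Ioi] with y hy
    have hy : 0 < y := hy
    have h1 : y ^ (Module.finrank ℝ R6 - 1) * (y ^ 2)⁻¹ = y ^ 3 := by
      simp only [finrank_euclideanSpace, Fintype.card_fin]
      field_simp
    rw [smul_eq_mul, ← mul_assoc, h1, Real.norm_of_nonneg (by positivity), add_comm y 1,
      show (-5 : ℝ) = 3 + (-8) by norm_num, Real.rpow_add (by positivity)]
    gcongr
    rw [show (3 : ℝ) = (3 : ℕ) by norm_num, Real.rpow_natCast]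
    gcongr
    linarith

theorem measurable_density_bodySet : Measurable (density bodySet) := by
  have := contDiff_headSq.continuous.measurable
  have := contDiff_tailSq.continuous.measurable
  rw [funext density_bodySet]
  fun_prop

theorem inv_headSq_add_mul_tailSq_le {m : ℝ} (hm : 0 < m) (hm1 : m ≤ 1) (x : R6) :
    (headSq x + m * tailSq x)⁻¹ ≤ m⁻¹ * (‖x‖ ^ 2)⁻¹ := by
  rcases eq_or_ne x 0 with rfl | hx
  · simp [headSq, tailSq]
  rw [← mul_inv]
  have : 0 < m * ‖x‖ ^ 2 := by positivity
  gcongr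
  rw [norm_sq_eq]
  nlinarith [headSq_nonneg x]

theorem density_bodySet_nonneg (x : R6) : 0 ≤ density bodySet x := by
  rcases eq_or_ne x 0 with rfl | hx
  · simp [density_bodySet, headSq, tailSq]
  have h2 := headSq_add_mul_tailSq_pos one_pos hx
  have h3 := headSq_add_mul_tailSq_pos (m := 1 / 2) (by norm_num) hx
  rw [density_bodySet, ← div_eq_mul_inv, inv_eq_one_div, sub_nonneg, div_le_div_iff₀ h3 h2]
  nlinarith [headSq_nonneg x, tailSq_nonneg x]

theorem density_bodySet_le (x : R6) : density bodySet x ≤ 3 * (‖x‖ ^ 2)⁻¹ := by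
  have h3 : 0 ≤ (headSq x + 1 / 2 * tailSq x)⁻¹ := by
    have := headSq_nonneg x
    have := tailSq_nonneg x
    positivity
  rw [density_bodySet, norm_sq_eq, one_mul]
  linarith

/-- The measure with density `density bodySet`. -/
def densityMeasure : Measure R6 :=
  volume.withDensity fun x => ENNReal.ofReal (density bodySet x)

theorem integrable_densityMeasure_iff {F : Type*} [NormedAddCommGroup F] [NormedSpace ℝ F]
    {g : R6 → F} :
    Integrable g densityMeasure ↔ Integrable (fun x => density bodySet x • g x) := by
  rw [densityMeasure, integrable_withDensity_iff_integrable_smul'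
    measurable_density_bodySet.ennreal_ofReal (by simp)]
  simp only [ENNReal.toReal_ofReal (density_bodySet_nonneg _)]

theorem integral_densityMeasure {F : Type*} [NormedAddCommGroup F] [NormedSpace ℝ F]
    (g : R6 → F) :
    ∫ x, g x ∂densityMeasure = ∫ x, density bodySet x • g x := by
  rw [densityMeasure, integral_withDensity_eq_integral_toReal_smul
    measurable_density_bodySet.ennreal_ofReal (by simp)]
  simp only [ENNReal.toReal_ofReal (density_bodySet_nonneg _)]

instance hasTemperateGrowth_densityMeasure : densityMeasure.HasTemperateGrowth := by
  refine ⟨8, integrable_densityMeasure_iff.2 ?_⟩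
  refine (integrable_inv_norm_sq_mul_one_add_norm_rpow.const_mul 3).mono' ?_
    (Filter.Eventually.of_forall fun x => ?_)
  · have := measurable_density_bodySet
    exact (by fun_prop : Measurable _).aestronglyMeasurable
  · rw [smul_eq_mul, Real.norm_of_nonneg (mul_nonneg (density_bodySet_nonneg x) (by positivity)),
      ← mul_assoc]
    push_cast
    gcongr
    exact density_bodySet_le x

theorem isGivenBy_densityMeasure :
    IsGivenBy densityMeasure.toTemperedDistribution (density bodySet) := by
  intro φ
  simp only [← Complex.real_smul]
  exact ⟨integrable_densityMeasure_iff.1 φ.integrable, integral_densityMeasure φ⟩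

/-! ### Pairing with a modulated Gaussian -/

/-- Lets the density dominate each of its two constituents, so their integrability against Gaussians
follows from that of the density. -/
theorem inv_norm_sq_le_density_bodySet (x : R6) : (‖x‖ ^ 2)⁻¹ ≤ density bodySet x := by
  rcases eq_or_ne x 0 with rfl | hx
  · simp [density_bodySet, headSq, tailSq]
  have h2 := headSq_add_mul_tailSq_pos one_pos hx
  have h3 := headSq_add_mul_tailSq_pos (m := 1 / 2) (by norm_num) hx
  rw [density_bodySet, norm_sq_eq, one_mul] at *
  have : (headSq x + 1 / 2 * tailSq x)⁻¹ ≤ 2 * (headSq x + tailSq x)⁻¹ := by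
    rw [← div_eq_mul_inv, inv_eq_one_div, div_le_div_iff₀ h3 h2]
    linarith [headSq_nonneg x]
  linarith

theorem norm_cexp_modulated (a : ℝ) (x : R6) :
    ‖Complex.exp (a * Complex.I * x 0 - ‖x‖ ^ 2 / 2)‖ = Real.exp (-‖x‖ ^ 2 / 2) := by
  rw [Complex.norm_exp, show (a : ℂ) * Complex.I * x 0 - (‖x‖ : ℂ) ^ 2 / 2
    = ((-‖x‖ ^ 2 / 2 : ℝ) : ℂ) + ((a * x 0 : ℝ) : ℂ) * Complex.I by push_cast; ring,
    Complex.add_re, Complex.re_ofReal_mul, Complex.I_re, mul_zero, add_zero, Complex.ofReal_re]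

theorem integrable_inv_mul_gaussian {m : ℝ} (hm : 0 < m) (hm1 : m ≤ 1) :
    Integrable (fun x : R6 => (headSq x + m * tailSq x)⁻¹ * Real.exp (-‖x‖ ^ 2 / 2)) := by
  have h := (isGivenBy_densityMeasure (SchwartzMap.convolution (ContinuousLinearMap.mul ℂ ℂ)
    (modulatedGaussian 0) (conjReflect (modulatedGaussian 0)))).1
  simp only [convolution_modulatedGaussian] at h
  refine (h.norm.const_mul (m⁻¹ * ((Real.pi / 2) ^ 3)⁻¹)).mono' ?_
    (Filter.Eventually.of_forall fun x => ?_)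
  · have := contDiff_headSq.continuous.measurable
    have := contDiff_tailSq.continuous.measurable
    exact (by fun_prop : Measurable _).aestronglyMeasurable
  · have hq : 0 ≤ (headSq x + m * tailSq x)⁻¹ := by
      have := headSq_nonneg x
      have := tailSq_nonneg x
      positivity
    rw [norm_mul (_ : ℂ), norm_mul (_ : ℂ), norm_cexp_modulated, Complex.norm_real,
      Complex.norm_real, Real.norm_of_nonneg (density_bodySet_nonneg x),
      Real.norm_of_nonneg (by positivity), Real.norm_of_nonneg (by positivity)]
    have hp : (Real.pi / 2) ^ 3 ≠ 0 := by positivity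
    calc (headSq x + m * tailSq x)⁻¹ * Real.exp (-‖x‖ ^ 2 / 2)
        ≤ (m⁻¹ * density bodySet x) * Real.exp (-‖x‖ ^ 2 / 2) := by
          gcongr
          exact (inv_headSq_add_mul_tailSq_le hm hm1 x).trans
            (by gcongr; exact inv_norm_sq_le_density_bodySet x)
      _ = _ := by field_simp

/-- The integrand obtained from writing `1 / (headSq x + m * tailSq x)` as a superposition of
Gaussians. -/
def gaussianKernel (a m : ℝ) (x : R6) (s : ℝ) : ℂ :=
  (Real.exp (-(headSq x + m * tailSq x) * s) : ℝ) *
    Complex.exp (a * Complex.I * x 0 - ‖x‖ ^ 2 / 2)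

theorem norm_gaussianKernel (a m : ℝ) (x : R6) (s : ℝ) :
    ‖gaussianKernel a m x s‖ =
      Real.exp (-(headSq x + m * tailSq x) * s) * Real.exp (-‖x‖ ^ 2 / 2) := by
  rw [gaussianKernel, norm_mul, norm_cexp_modulated, Complex.norm_real,
    Real.norm_of_nonneg (Real.exp_pos _).le]

theorem continuous_gaussianKernel (a m : ℝ) :
    Continuous (Function.uncurry (gaussianKernel a m)) := by
  have := contDiff_headSq.continuous
  have := contDiff_tailSq.continuous
  unfold gaussianKernel Function.uncurry
  fun_prop

theorem integral_exp_neg_mul_Ioi_zero {q : ℝ} (hq : 0 < q) :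
    ∫ s in Set.Ioi (0 : ℝ), Real.exp (-q * s) = q⁻¹ := by
  rw [integral_exp_mul_Ioi (by linarith)]
  simp [neg_div_neg_eq]

theorem integrable_gaussianKernel (a : ℝ) {m : ℝ} (hm : 0 < m) (hm1 : m ≤ 1) :
    Integrable (Function.uncurry (gaussianKernel a m))
      ((volume : Measure R6).prod (volume.restrict (Set.Ioi (0 : ℝ)))) := by
  have hne : ∀ᵐ x : R6, x ≠ 0 := by simp [ae_iff]
  rw [integrable_prod_iff (continuous_gaussianKernel a m).aestronglyMeasurable]
  constructor
  · filter_upwards [hne] with x hx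
    have hq := headSq_add_mul_tailSq_pos hm hx
    simp only [Function.uncurry_apply_pair, gaussianKernel]
    exact (integrableOn_exp_mul_Ioi (neg_lt_zero.2 hq) 0).ofReal.mul_const _
  · refine (integrable_inv_mul_gaussian hm hm1).congr ?_
    filter_upwards [hne] with x hx
    have hq := headSq_add_mul_tailSq_pos hm hx
    simp only [Function.uncurry_apply_pair, norm_gaussianKernel]
    rw [integral_mul_const, integral_exp_neg_mul_Ioi_zero hq]

/-- The Fourier transform of an anisotropic Gaussian, along the first coordinate axis. -/
def gaussianTransform (a m s : ℝ) : ℝ :=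
  Real.pi ^ 3 / ((s + 1 / 2) * (m * s + 1 / 2) ^ 2) * Real.exp (-(a ^ 2 / 4) / (s + 1 / 2))

theorem integral_gaussianKernel (a : ℝ) {m s : ℝ} (hm : 0 < m) (hs : 0 < s) :
    ∫ x : R6, gaussianKernel a m x s = gaussianTransform a m s := by
  set p : ℝ := s + 1 / 2 with hp
  set r : ℝ := m * s + 1 / 2 with hr
  have hp0 : 0 < p := by positivity
  have hr0 : 0 < r := by positivity
  have key := GaussianFourier.integral_cexp_neg_sum_mul_add (ι := Fin 6)
    (b := ![(p : ℂ), p, r, r, r, r]) (by simp [Fin.forall_fin_succ, hp0, hr0])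
    ![a * Complex.I, 0, 0, 0, 0, 0]
  rw [← (PiLp.volume_preserving_toLp (Fin 6)).integral_comp
    (MeasurableEquiv.toLp 2 _).measurableEmbedding]
  -- The six Gaussian factors come in equal pairs, so all complex square roots cancel.
  have hsq : ∀ z : ℂ, (z ^ (1 / 2 : ℂ)) * (z ^ (1 / 2 : ℂ)) = z := by
    intro z
    rw [← sq, ← Complex.cpow_nat_mul]
    simp
  calc _ = ∫ v : Fin 6 → ℝ, Complex.exp (-∑ i, ![(p : ℂ), p, r, r, r, r] i * (v i : ℂ) ^ 2
        + ∑ i, ![a * Complex.I, 0, 0, 0, 0, 0] i * (v i : ℂ)) := by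
        refine integral_congr_ae (Filter.Eventually.of_forall fun v => ?_)
        have hn : (‖(WithLp.toLp 2 v : R6)‖ : ℂ) ^ 2
            = ((headSq (WithLp.toLp 2 v) + tailSq (WithLp.toLp 2 v) : ℝ) : ℂ) := by
          rw [← norm_sq_eq]; push_cast; rfl
        simp only [gaussianKernel]
        rw [hn, Complex.ofReal_exp, ← Complex.exp_add]
        congr 1
        simp [Fin.sum_univ_six, headSq, tailSq, hp, hr]
        ring
    _ = _ := by
        rw [key, Fin.prod_univ_six]
        simp only [Matrix.cons_val]
        have h1 := hsq (Real.pi / p)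
        have h2 := hsq (Real.pi / r)
        generalize ((Real.pi : ℂ) / p) ^ (1 / 2 : ℂ) = u at *
        generalize ((Real.pi : ℂ) / r) ^ (1 / 2 : ℂ) = w at *
        have he : ((a : ℂ) * Complex.I) ^ 2 / (4 * p)
            = ((-(a ^ 2 / 4) / p : ℝ) : ℂ) := by
          rw [mul_pow, Complex.I_sq]
          push_cast
          field_simp
        rw [he]
        simp only [gaussianTransform, ← hp, ← hr]
        push_cast
        simp only [ne_eq, OfNat.ofNat_ne_zero, not_false_eq_true, zero_pow, zero_div,
          Complex.exp_zero, mul_one]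
        have hpi : (Real.pi : ℂ) ^ 3 / (p * r ^ 2)
            = (Real.pi / p) * (Real.pi / r) * (Real.pi / r) := by
          have : (p : ℂ) ≠ 0 := by exact_mod_cast hp0.ne'
          have : (r : ℂ) ≠ 0 := by exact_mod_cast hr0.ne'
          field_simp
        rw [hpi, ← h1, ← h2]
        ring

theorem integrableOn_gaussianTransform (a : ℝ) {m : ℝ} (hm : 0 < m) (hm1 : m ≤ 1) :
    IntegrableOn (gaussianTransform a m) (Set.Ioi 0) := by
  have h := (integrable_gaussianKernel a hm hm1).integral_prod_right.re
  refine h.congr ?_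
  filter_upwards [ae_restrict_mem measurableSet_Ioi] with s hs
  simp only [Function.uncurry_apply_pair]
  rw [integral_gaussianKernel a hm hs]
  simp

theorem integral_inv_mul_modulatedGaussian (a : ℝ) {m : ℝ} (hm : 0 < m) (hm1 : m ≤ 1) :
    ∫ x : R6, ((headSq x + m * tailSq x)⁻¹ : ℝ) *
        Complex.exp (a * Complex.I * x 0 - ‖x‖ ^ 2 / 2) =
      (∫ s in Set.Ioi 0, gaussianTransform a m s : ℝ) := by
  have hne : ∀ᵐ x : R6, x ≠ 0 := by simp [ae_iff]
  calc _ = ∫ x : R6, ∫ s in Set.Ioi (0 : ℝ), gaussianKernel a m x s := by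
        refine integral_congr_ae ?_
        filter_upwards [hne] with x hx
        simp only [gaussianKernel]
        rw [integral_mul_const, integral_complex_ofReal,
          integral_exp_neg_mul_Ioi_zero (headSq_add_mul_tailSq_pos hm hx)]
    _ = ∫ s in Set.Ioi (0 : ℝ), ∫ x : R6, gaussianKernel a m x s :=
        integral_integral_swap (integrable_gaussianKernel a hm hm1)
    _ = ∫ s in Set.Ioi (0 : ℝ), (gaussianTransform a m s : ℂ) :=
        setIntegral_congr_fun measurableSet_Ioi fun s hs => integral_gaussianKernel a hm hs
    _ = _ := integral_complex_ofReal

theorem integrable_inv_mul_modulatedGaussian (a : ℝ) {m : ℝ} (hm : 0 < m) (hm1 : m ≤ 1) :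
    Integrable (fun x : R6 => (((headSq x + m * tailSq x)⁻¹ : ℝ) : ℂ) *
        Complex.exp (a * Complex.I * x 0 - ‖x‖ ^ 2 / 2)) := by
  refine (integrable_inv_mul_gaussian hm hm1).mono' ?_ (Filter.Eventually.of_forall fun x => ?_)
  · have := contDiff_headSq.continuous.measurable
    have := contDiff_tailSq.continuous.measurable
    exact (by fun_prop : Measurable _).aestronglyMeasurable
  · have hq : 0 ≤ (headSq x + m * tailSq x)⁻¹ := by
      have := headSq_nonneg x
      have := tailSq_nonneg x
      positivity
    rw [norm_mul, norm_cexp_modulated, Complex.norm_real, Real.norm_of_nonneg hq]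

theorem densityMeasure_apply_autocorrelation (a : ℝ) :
    densityMeasure.toTemperedDistribution
        (SchwartzMap.convolution (ContinuousLinearMap.mul ℂ ℂ) (modulatedGaussian a)
          (conjReflect (modulatedGaussian a))) =
      ((Real.pi / 2) ^ 3 * ∫ s in Set.Ioi 0,
        (3 * gaussianTransform a 1 s - gaussianTransform a (1 / 2) s) : ℝ) := by
  have h1 := integrable_inv_mul_modulatedGaussian a one_pos le_rfl
  have h2 := integrable_inv_mul_modulatedGaussian a (m := 1 / 2) (by norm_num) (by norm_num)
  have h3 := integrableOn_gaussianTransform a one_pos le_rfl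
  have h4 := integrableOn_gaussianTransform a (m := 1 / 2) (by norm_num) (by norm_num)
  rw [(isGivenBy_densityMeasure _).2, integral_sub (h3.const_mul 3) h4, integral_const_mul]
  push_cast
  rw [← integral_inv_mul_modulatedGaussian a one_pos le_rfl,
    ← integral_inv_mul_modulatedGaussian a (m := 1 / 2) (by norm_num) (by norm_num),
    ← integral_const_mul, ← integral_sub (h1.const_mul 3) h2, ← integral_const_mul]
  refine integral_congr_ae (Filter.Eventually.of_forall fun x => ?_)
  simp only [convolution_modulatedGaussian, density_bodySet]
  push_cast
  ring

/-! ### Negativity -/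

theorem hasDerivAt_exp_div_sq {s : ℝ} (hs : 0 ≤ s) :
    HasDerivAt (fun s : ℝ => Real.exp (-8 / (s + 1 / 2)) / (2 * (s + 1 / 2) ^ 2))
      ((4 / (s + 1 / 2) ^ 4 - 1 / (s + 1 / 2) ^ 3) * Real.exp (-8 / (s + 1 / 2))) s := by
  have ht : s + 1 / 2 ≠ 0 := by positivity
  have h1 : HasDerivAt (fun s : ℝ => s + 1 / 2) 1 s := (hasDerivAt_id s).add_const _
  have h2 := (((hasDerivAt_const s (-8 : ℝ)).div h1 ht).exp).div ((h1.pow 2).const_mul 2)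
    (show 2 * (s + 1 / 2) ^ 2 ≠ 0 by positivity)
  refine h2.congr_deriv ?_
  simp only [Pi.pow_apply, Pi.div_apply]
  field_simp
  ring

/-- With t = s + 1/2 the rational factor is 3/t³ - 4/(t(t + 1/2)²), at most 4/t⁴ - 1/t³. The
derivative of exp(-c/t)/(2t²) is (c/(2t⁴) - 1/t³) exp(-c/t), so c = a²/4 = 8 makes the bound exact;
hence a² = 32. -/
theorem gaussianTransform_combination_le {a s : ℝ} (ha : a ^ 2 = 32) (hs : 0 < s) :
    3 * gaussianTransform a 1 s - gaussianTransform a (1 / 2) s ≤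
      Real.pi ^ 3 * ((4 / (s + 1 / 2) ^ 4 - 1 / (s + 1 / 2) ^ 3) *
        Real.exp (-8 / (s + 1 / 2))) := by
  have hrat : 3 / ((s + 1 / 2) * (1 * s + 1 / 2) ^ 2) - 1 / ((s + 1 / 2) * (1 / 2 * s + 1 / 2) ^ 2)
      ≤ 4 / (s + 1 / 2) ^ 4 - 1 / (s + 1 / 2) ^ 3 := by
    have : 4 / (s + 1 / 2) ^ 4 - 1 / (s + 1 / 2) ^ 3 -
        (3 / ((s + 1 / 2) * (1 * s + 1 / 2) ^ 2) - 1 / ((s + 1 / 2) * (1 / 2 * s + 1 / 2) ^ 2))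
        = (3 * (s + 1 / 2) + 1) / ((s + 1 / 2) ^ 4 * (s + 1) ^ 2) := by
      field_simp
      ring
    have : 0 ≤ (3 * (s + 1 / 2) + 1) / ((s + 1 / 2) ^ 4 * (s + 1) ^ 2) := by positivity
    linarith
  have he : -(a ^ 2 / 4) / (s + 1 / 2) = -8 / (s + 1 / 2) := by rw [ha]; norm_num
  calc 3 * gaussianTransform a 1 s - gaussianTransform a (1 / 2) s
      = Real.pi ^ 3 * ((3 / ((s + 1 / 2) * (1 * s + 1 / 2) ^ 2)
        - 1 / ((s + 1 / 2) * (1 / 2 * s + 1 / 2) ^ 2)) * Real.exp (-8 / (s + 1 / 2))) := by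
        rw [gaussianTransform, gaussianTransform, he]; ring
    _ ≤ _ := by gcongr

theorem integral_gaussianTransform_combination_neg {a : ℝ} (ha : a ^ 2 = 32) :
    ∫ s in Set.Ioi 0, (3 * gaussianTransform a 1 s - gaussianTransform a (1 / 2) s) < 0 := by
  have h3 := integrableOn_gaussianTransform a one_pos le_rfl
  have h4 := integrableOn_gaussianTransform a (m := 1 / 2) (by norm_num) (by norm_num)
  have he : ∀ s : ℝ, -(a ^ 2 / 4) / (s + 1 / 2) = -8 / (s + 1 / 2) := fun s => by
    rw [ha]; norm_num
  have hint : IntegrableOn (fun s : ℝ => (4 / (s + 1 / 2) ^ 4 - 1 / (s + 1 / 2) ^ 3) *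
      Real.exp (-8 / (s + 1 / 2))) (Set.Ioi 0) := by
    refine (h3.const_mul (9 / Real.pi ^ 3)).mono' ?_ ?_
    · exact (by fun_prop : Measurable _).aestronglyMeasurable
    · filter_upwards [ae_restrict_mem measurableSet_Ioi] with s hs
      have hs : 0 < s := hs
      rw [gaussianTransform, he, norm_mul, Real.norm_of_nonneg (Real.exp_pos _).le, ← mul_assoc]
      gcongr
      -- Since s + 1/2 ≥ 1/2, the total is at most (8 + 1)/(s + 1/2)³, whence the factor 9.
      have h8 : 4 / (s + 1 / 2) ^ 4 ≤ 8 / (s + 1 / 2) ^ 3 := by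
        rw [div_le_div_iff₀ (by positivity) (by positivity)]
        have : 0 ≤ s * (s + 1 / 2) ^ 3 := by positivity
        nlinarith
      have h9 : 9 / Real.pi ^ 3 * (Real.pi ^ 3 / ((s + 1 / 2) * (1 * s + 1 / 2) ^ 2))
          = 8 / (s + 1 / 2) ^ 3 + 1 / (s + 1 / 2) ^ 3 := by
        field_simp
        norm_num
      have p1 : 0 ≤ 4 / (s + 1 / 2) ^ 4 := by positivity
      have p2 : 0 ≤ 1 / (s + 1 / 2) ^ 3 := by positivity
      rw [h9, Real.norm_eq_abs, abs_le]
      constructor <;> linarith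
  have hlim : Filter.Tendsto (fun s : ℝ => Real.exp (-8 / (s + 1 / 2)) / (2 * (s + 1 / 2) ^ 2))
      Filter.atTop (nhds 0) := by
    have h1 : Filter.Tendsto (fun s : ℝ => s + 1 / 2) Filter.atTop Filter.atTop :=
      Filter.tendsto_atTop_add_const_right _ _ Filter.tendsto_id
    have h2 := (Real.continuous_exp.tendsto _).comp (h1.const_div_atTop (-8))
    exact h2.div_atTop (((Filter.tendsto_pow_atTop two_ne_zero).comp h1).const_mul_atTop two_pos)
  -- The primitive vanishes at infinity and is positive at 0, so the integral is negative.
  have hval := integral_Ioi_of_hasDerivAt_of_tendsto'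
    (fun s hs => hasDerivAt_exp_div_sq hs) hint hlim
  calc _ ≤ ∫ s in Set.Ioi 0, Real.pi ^ 3 * ((4 / (s + 1 / 2) ^ 4 - 1 / (s + 1 / 2) ^ 3) *
        Real.exp (-8 / (s + 1 / 2))) :=
        setIntegral_mono_on ((h3.const_mul 3).sub h4) (hint.const_mul _) measurableSet_Ioi
          fun s hs => gaussianTransform_combination_le ha hs
    _ < 0 := by
        rw [integral_const_mul, hval, zero_sub]
        have : 0 < Real.exp (-8 / ((0 : ℝ) + 1 / 2)) / (2 * (0 + 1 / 2) ^ 2) := by positivity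
        exact mul_neg_of_pos_of_neg (by positivity) (neg_lt_zero.2 this)

theorem not_isPositiveDefinite_densityMeasure :
    ¬ IsPositiveDefinite densityMeasure.toTemperedDistribution := by
  intro h
  have h1 := h (modulatedGaussian (√32))
  rw [densityMeasure_apply_autocorrelation, Complex.zero_le_real] at h1
  have h2 := integral_gaussianTransform_combination_neg (a := √32) (Real.sq_sqrt (by norm_num))
  have h3 : 0 < (Real.pi / 2) ^ 3 := by positivity
  nlinarith

end

theorem lemma9 :
    ∃ K : ConvexBody R6,
      (0 : R6) ∈ interior (K : Set R6) ∧
      (K : Set R6) ⊆ ball 0 1 ∧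
      IsRotationInvariant (K : Set R6) ∧
      IsInfinitelySmooth (K : Set R6) ∧
      ∃ T : 𝓢'(R6, ℂ), IsGivenBy T (density (K : Set R6)) ∧ ¬ IsPositiveDefinite T :=
  ⟨body, zero_mem_interior_bodySet, bodySet_subset_ball, isRotationInvariant_bodySet,
    isInfinitelySmooth_bodySet, densityMeasure.toTemperedDistribution,
    isGivenBy_densityMeasure, not_isPositiveDefinite_densityMeasure⟩
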